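/- Let $\ell\ge 2$ be an integer and let $\gamma\in\left(0,\frac{\ell-1}{\ell^2+2\ell}\right)$ be a real constant. Then for every sufficiently large integer $n$ (depending on $\ell$ and $\gamma$) there exists an $n$-vertex $K_{\ell+1}$-free graph $G_\ell$ such that $\alpha_\ell(G_\ell)\le n^{1-\gamma}$. Here, for a finite graph $G$, the $\ell$-independence number $\alpha_\ell(G)$ is the maximum size of a set $A\subseteq V(G)$ such that the induced subgraph $G[A]$ contains no copy of $K_\ell$. -/

import Mathlib

open Classical in
/-- The `ℓ`-independence number `α_ℓ(G)` of a finite graph `G`: the maximum size of a set of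
vertices that spans no clique on `ℓ` vertices.  For `ℓ ≥ 1` the empty set is such a set, so this
is a maximum over a nonempty finite family. -/
noncomputable def cliqueIndepNum {V : Type*} [Fintype V] (G : SimpleGraph V) (ℓ : ℕ) : ℕ :=
  (Finset.univ.filter fun A : Finset V => G.CliqueFreeOn (A : Set V) ℓ).sup Finset.card

/-! In the affine space over a field with `q` elements, the lines of direction `(1, t, t ^ 2)` form
no triangle, because three distinct points of the moment curve are linearly independent
(`momentLine_no_triangle`). Put a complete `ℓ`-partite graph on each line: a clique then lies on one
line, so it has at most `ℓ` vertices. Choose the parts at random. A `K_ℓ`-free set `A` misses a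
colour on each of the `q ^ 3` lines. There are at most `(2 * ℓ) ^ q ^ 3` choices of `A` and of
missed colours, and each occurs with probability `(1 - 1 / ℓ) ^ (q * |A|)`. For `M` constant and
large, the union bound rules out `|A| ≥ M * q ^ 2`. With `q` a prime of order `n ^ (1 / 3)` this
gives `O(n ^ (2 / 3))`, enough for every `γ < 1 / 3`. -/

/-- Union bound for random colourings: if few prescriptions `f j` are given, each on a large set
`S j`, then some colouring agrees with every prescription somewhere on its set. -/
theorem exists_coloring_agreeing_somewhere {X J K : Type*} [Fintype X] [Fintype J] [Fintype K]
    [Nonempty K] (m : ℕ) (f : J → X → K) (S : J → Finset X) (hS : ∀ j, m ≤ (S j).card)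
    (hJ : Fintype.card J * (Fintype.card K - 1) ^ m < Fintype.card K ^ m) :
    ∃ c : X → K, ∀ j, ∃ x ∈ S j, c x = f j x := by
  classical
  rcases isEmpty_or_nonempty J with hE | ⟨⟨j₀⟩⟩
  · exact ⟨fun _ => Classical.arbitrary K, fun j => hE.elim j⟩
  choose T hTS hT using fun j => Finset.exists_subset_card_eq (hS j)
  have hmX : m ≤ Fintype.card X := (hT j₀) ▸ (T j₀).card_le_univ
  -- The bad event for `j`: the colouring avoids `f j` on all of `T j`. Trimming `S j` to exactly
  -- `m` points makes all bad events equally large.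
  let B : J → Finset (X → K) := fun j =>
    Fintype.piFinset fun x => if x ∈ T j then Finset.univ.erase (f j x) else Finset.univ
  have hB (j : J) : (B j).card =
      (Fintype.card K - 1) ^ m * Fintype.card K ^ (Fintype.card X - m) := by
    have (x : X) : (if x ∈ T j then Finset.univ.erase (f j x) else Finset.univ).card =
        if x ∈ T j then Fintype.card K - 1 else Fintype.card K := by
      split_ifs <;> simp
    simp only [B, Fintype.card_piFinset, this, Finset.prod_ite, Finset.prod_const]
    rw [Finset.filter_mem_eq_inter, Finset.univ_inter, hT, Finset.filter_not,
      Finset.filter_mem_eq_inter, Finset.univ_inter, ← Finset.compl_eq_univ_sdiff,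
      Finset.card_compl, hT]
  have hlt : (Finset.univ.biUnion B).card < (Finset.univ : Finset (X → K)).card := by
    calc (Finset.univ.biUnion B).card
        ≤ ∑ j, (B j).card := Finset.card_biUnion_le
      _ = (Fintype.card J * (Fintype.card K - 1) ^ m) *
            Fintype.card K ^ (Fintype.card X - m) := by
          simp [hB, mul_assoc]
      _ < Fintype.card K ^ m * Fintype.card K ^ (Fintype.card X - m) :=
          Nat.mul_lt_mul_of_pos_right hJ (pow_pos Fintype.card_pos _)
      _ = (Finset.univ : Finset (X → K)).card := by
          rw [← pow_add, Nat.add_sub_cancel' hmX, Finset.card_univ, Fintype.card_fun]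
  obtain ⟨c, -, hc⟩ := Finset.exists_mem_notMem_of_card_lt_card hlt
  refine ⟨c, fun j => ?_⟩
  by_contra! h
  refine hc (Finset.mem_biUnion.2 ⟨j, Finset.mem_univ _, Fintype.mem_piFinset.2 fun x => ?_⟩)
  split_ifs with hx
  · exact Finset.mem_erase.2 ⟨h x (hTS j hx), Finset.mem_univ _⟩
  · exact Finset.mem_univ _

/-- The line of direction `(1, t, t ^ 2)` through a point of the affine space, encoded by its
intersection with the plane where the first coordinate vanishes. -/
def momentLine {F : Type*} [CommRing F] (t : F) (v : F × F × F) : F × F :=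
  (v.2.1 - t * v.1, v.2.2 - t ^ 2 * v.1)

theorem momentLine_eq_iff {F : Type*} [CommRing F] {t : F} {u v : F × F × F} :
    momentLine t u = momentLine t v ↔
      v.2.1 - u.2.1 = t * (v.1 - u.1) ∧ v.2.2 - u.2.2 = t ^ 2 * (v.1 - u.1) := by
  simp only [momentLine, Prod.mk.injEq]
  constructor
  · rintro ⟨h1, h2⟩
    exact ⟨by linear_combination -h1, by linear_combination -h2⟩
  · rintro ⟨h1, h2⟩
    exact ⟨by linear_combination -h1, by linear_combination -h2⟩

theorem fst_ne_of_momentLine_eq {F : Type*} [CommRing F] {t : F} {u v : F × F × F}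
    (h : momentLine t u = momentLine t v) (huv : u ≠ v) : v.1 - u.1 ≠ 0 := by
  intro h0
  obtain ⟨h1, h2⟩ := momentLine_eq_iff.1 h
  rw [h0, mul_zero, sub_eq_zero] at h1 h2
  exact huv (Prod.ext (sub_eq_zero.1 h0).symm (Prod.ext h1.symm h2.symm))

/-- Two distinct points lie on at most one common line. -/
theorem momentLine_unique {F : Type*} [Field F] {s t : F} {u v : F × F × F} (huv : u ≠ v)
    (hs : momentLine s u = momentLine s v) (ht : momentLine t u = momentLine t v) : s = t := by
  have h0 := fst_ne_of_momentLine_eq hs huv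
  exact mul_right_cancel₀ h0
    ((momentLine_eq_iff.1 hs).1.symm.trans (momentLine_eq_iff.1 ht).1)

/-- The lines with directions on the moment curve span no triangle. -/
theorem momentLine_no_triangle {F : Type*} [Field F] {r s t : F} {u v w : F × F × F}
    (huv : u ≠ v) (hvw : v ≠ w) (huw : u ≠ w)
    (ht : momentLine t u = momentLine t v) (hs : momentLine s v = momentLine s w)
    (hr : momentLine r u = momentLine r w) : r = t := by
  have ha := fst_ne_of_momentLine_eq ht huv
  have hb := fst_ne_of_momentLine_eq hs hvw
  have hc := fst_ne_of_momentLine_eq hr huw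
  obtain ⟨t1, t2⟩ := momentLine_eq_iff.1 ht
  obtain ⟨s1, s2⟩ := momentLine_eq_iff.1 hs
  obtain ⟨r1, r2⟩ := momentLine_eq_iff.1 hr
  have e1 : t * (v.1 - u.1) + s * (w.1 - v.1) = r * (w.1 - u.1) := by
    linear_combination r1 - t1 - s1
  have e2 : t ^ 2 * (v.1 - u.1) + s ^ 2 * (w.1 - v.1) = r ^ 2 * (w.1 - u.1) := by
    linear_combination r2 - t2 - s2
  -- Eliminating `w.1 - v.1` from `e1` and `e2` leaves this product times `v.1 - u.1`.
  have e3 : (t - r) * (t - s) = 0 := by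
    refine (mul_eq_zero.1 (?_ : (t - r) * (t - s) * (v.1 - u.1) = 0)).resolve_right ha
    linear_combination e2 - (r + s) * e1
  rcases mul_eq_zero.1 e3 with h | h
  · exact (sub_eq_zero.1 h).symm
  · refine mul_right_cancel₀ hc ?_
    linear_combination -e1 - (w.1 - v.1) * h

/-- The union of complete multipartite graphs on the lines with directions on the moment curve,
where `c (t, v)` is the part of `v` in its line of direction `(1, t, t ^ 2)`. -/
def momentGraph {F K : Type*} [CommRing F] (c : F × F × F × F → K) :
    SimpleGraph (F × F × F) where
  Adj u v := ∃ t, momentLine t u = momentLine t v ∧ c (t, u) ≠ c (t, v)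
  symm := ⟨fun _ _ ⟨t, h1, h2⟩ => ⟨t, h1.symm, h2.symm⟩⟩
  loopless := ⟨fun _ ⟨_, _, h⟩ => h rfl⟩

/-- One edge of a clique fixes a line; having no triangle of lines forces all other vertices onto
it, where adjacent vertices have different colours among `ℓ`. -/
theorem momentGraph_cliqueFree {F : Type*} [Field F] {ℓ : ℕ} (hℓ : 2 ≤ ℓ)
    (c : F × F × F × F → Fin ℓ) : (momentGraph c).CliqueFree (ℓ + 1) := by
  intro A hA
  obtain ⟨hA, hcard⟩ := hA
  obtain ⟨u, v, hu, hv, huv⟩ := Finset.one_lt_card_iff.1 (by omega : 1 < A.card)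
  obtain ⟨t, htl, htc⟩ := hA hu hv huv
  have key : ∀ w ∈ A, momentLine t u = momentLine t w := by
    intro w hw
    by_cases huw : u = w
    · rw [huw]
    by_cases hvw : v = w
    · rwa [← hvw]
    obtain ⟨s, hs, -⟩ := hA hv hw hvw
    obtain ⟨r, hr, -⟩ := hA hu hw huw
    rwa [← momentLine_no_triangle huv hvw huw htl hs hr]
  have hinj : Set.InjOn (fun w => c (t, w)) (A : Set (F × F × F)) := by
    intro x hx y hy hxy
    by_contra hne
    obtain ⟨s, hs, hsc⟩ := hA hx hy hne
    have : s = t := momentLine_unique hne hs ((key x hx).symm.trans (key y hy))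
    exact hsc (this ▸ hxy)
  have := Finset.card_le_card_of_injOn (t := Finset.univ) _ (fun _ _ => Finset.mem_univ _) hinj
  rw [Finset.card_univ, Fintype.card_fin] at this
  omega

/-- If a set spans no `K_ℓ` in the graph, then every line misses a colour on this set. -/
theorem exists_missed_color {F : Type*} [CommRing F] {ℓ : ℕ} {c : F × F × F × F → Fin ℓ}
    {A : Finset (F × F × F)} (hA : (momentGraph c).CliqueFreeOn (A : Set (F × F × F)) ℓ)
    (t : F) (L : F × F) : ∃ i, ∀ v ∈ A, momentLine t v = L → c (t, v) ≠ i := by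
  classical
  by_contra! h
  choose g hgA hgL hgc using h
  have hinj : Function.Injective g := fun i j hij => by rw [← hgc i, ← hgc j, hij]
  refine hA (t := Finset.univ.image g) (by simpa [Set.range_subset_iff] using hgA) ⟨?_, ?_⟩
  · intro x hx y hy hxy
    simp only [Finset.coe_image, Finset.coe_univ, Set.image_univ, Set.mem_range] at hx hy
    obtain ⟨i, rfl⟩ := hx
    obtain ⟨j, rfl⟩ := hy
    exact ⟨t, (hgL i).trans (hgL j).symm, fun hc => hxy (by rw [hgc, hgc] at hc; rw [hc])⟩
  · rw [Finset.card_image_of_injective _ hinj, Finset.card_univ, Fintype.card_fin]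

/-- Since `(1 - 1 / ℓ) ^ M` tends to `0`, the constant `M` can depend on `ℓ` alone. -/
theorem exists_mul_pow_pred_lt_pow (ℓ C : ℕ) (hℓ : 0 < ℓ) :
    ∃ M : ℕ, C * (ℓ - 1) ^ M < ℓ ^ M := by
  have hl : (0 : ℝ) < ℓ := by exact_mod_cast hℓ
  have h1 : ((ℓ - 1 : ℕ) : ℝ) / ℓ < 1 := by
    rw [div_lt_one hl]
    exact_mod_cast Nat.sub_lt hℓ one_pos
  obtain ⟨M, hM⟩ := exists_pow_lt_of_lt_one (show (0 : ℝ) < 1 / (C + 1) by positivity) h1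
  refine ⟨M, ?_⟩
  rw [div_pow, div_lt_div_iff₀ (by positivity) (by positivity)] at hM
  have h2 : (C : ℝ) * ((ℓ - 1 : ℕ) : ℝ) ^ M < (ℓ : ℝ) ^ M := by
    have : (0 : ℝ) ≤ ((ℓ - 1 : ℕ) : ℝ) ^ M := by positivity
    nlinarith
  exact_mod_cast h2

/-- Some colouring of the lines leaves no `K_ℓ`-free set with `M q ^ 2` points. -/
theorem exists_momentGraph_no_large_cliqueFreeOn {F : Type*} [Field F] [Fintype F] {ℓ M : ℕ}
    (hℓ : 0 < ℓ) (hM : 2 * ℓ * (ℓ - 1) ^ M < ℓ ^ M) :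
    ∃ c : F × F × F × F → Fin ℓ, ∀ A : Finset (F × F × F),
      (momentGraph c).CliqueFreeOn (A : Set (F × F × F)) ℓ → A.card < M * Fintype.card F ^ 2 := by
  classical
  have : Nonempty (Fin ℓ) := ⟨⟨0, hℓ⟩⟩
  set q := Fintype.card F with hq
  have hq0 : 0 < q := Fintype.card_pos
  -- A large set with a guess of the missed colour of each line, a line being a pair of a direction
  -- `t` and a point of `F × F`.
  let J := {A : Finset (F × F × F) // M * q ^ 2 ≤ A.card} × (F × F × F → Fin ℓ)
  have hJ : Fintype.card J ≤ (2 * ℓ) ^ q ^ 3 := by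
    have hV : Fintype.card (F × F × F) = q ^ 3 := by
      simp only [Fintype.card_prod, ← hq]
      ring
    rw [Fintype.card_prod, Fintype.card_fun, Fintype.card_fin, hV, mul_pow]
    refine Nat.mul_le_mul_right _ ((Fintype.card_subtype_le _).trans ?_)
    rw [Fintype.card_finset, hV]
  -- The colouring lives on incidences `(t, v)`, so `A` contributes `q * |A|` independent colours.
  -- Agreement at one of them means that a guessed colour does occur.
  obtain ⟨c, hc⟩ := exists_coloring_agreeing_somewhere (M * q ^ 3)
    (fun (j : J) (x : F × F × F × F) => j.2 (x.1, momentLine x.1 x.2))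
    (fun j => Finset.univ ×ˢ j.1.1)
    (fun j => by
      rw [Finset.card_product, Finset.card_univ, ← hq]
      calc M * q ^ 3 = q * (M * q ^ 2) := by ring
        _ ≤ _ := Nat.mul_le_mul_left _ j.1.2)
    (by
      rw [Fintype.card_fin, pow_mul, pow_mul]
      calc Fintype.card J * ((ℓ - 1) ^ M) ^ q ^ 3
          ≤ (2 * ℓ) ^ q ^ 3 * ((ℓ - 1) ^ M) ^ q ^ 3 := Nat.mul_le_mul_right _ hJ
        _ = (2 * ℓ * (ℓ - 1) ^ M) ^ q ^ 3 := (mul_pow _ _ _).symm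
        _ < (ℓ ^ M) ^ q ^ 3 := Nat.pow_lt_pow_left hM (pow_pos hq0 3).ne')
  refine ⟨c, fun A hA => ?_⟩
  by_contra! hcard
  choose i hi using exists_missed_color hA
  obtain ⟨⟨t, v⟩, hv, h⟩ := hc (⟨A, hcard⟩, fun x => i x.1 x.2)
  exact hi t _ v (Finset.mem_product.1 hv).2 rfl h

/-- Passing to an induced subgraph reaches every `n`, not only cubes of primes. -/
theorem cliqueIndepNum_comap_le {V W : Type*} [Fintype V] (G : SimpleGraph W) (e : V ↪ W)
    {ℓ b : ℕ} (h : ∀ A : Finset W, G.CliqueFreeOn (A : Set W) ℓ → A.card ≤ b) :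
    cliqueIndepNum (G.comap e) ℓ ≤ b := by
  classical
  refine Finset.sup_le fun A hA => ?_
  rw [← Finset.card_map e]
  refine h _ fun T hT hclique => ?_
  obtain ⟨B, hBA, rfl⟩ := Finset.subset_map_iff.1 (Finset.coe_subset.1 hT)
  refine (Finset.mem_filter.1 hA).2 (Finset.coe_subset.2 hBA) ⟨?_, ?_⟩
  · intro x hx y hy hxy
    exact hclique.1 (Finset.mem_map_of_mem e hx) (Finset.mem_map_of_mem e hy)
      (e.injective.ne hxy)
  · rw [← hclique.2, Finset.card_map]

theorem exists_cliqueFree_cliqueIndepNum_le {ℓ M : ℕ} (hℓ : 2 ≤ ℓ)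
    (hM : 2 * ℓ * (ℓ - 1) ^ M < ℓ ^ M) {n p : ℕ} (hp : p.Prime) (hn : n ≤ p ^ 3) :
    ∃ G : SimpleGraph (Fin n), G.CliqueFree (ℓ + 1) ∧ cliqueIndepNum G ℓ ≤ M * p ^ 2 := by
  have : Fact p.Prime := ⟨hp⟩
  obtain ⟨c, hc⟩ := exists_momentGraph_no_large_cliqueFreeOn (F := ZMod p) (by omega) hM
  have hcard : Fintype.card (Fin n) ≤ Fintype.card (ZMod p × ZMod p × ZMod p) := by
    simp only [Fintype.card_fin, Fintype.card_prod, ZMod.card]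
    linarith [show p ^ 3 = p * (p * p) by ring]
  obtain ⟨e⟩ := Function.Embedding.nonempty_of_card_le hcard
  refine ⟨(momentGraph c).comap e, (momentGraph_cliqueFree hℓ c).comap
    ⟨(SimpleGraph.Embedding.comap e _).toCopy⟩, ?_⟩
  refine cliqueIndepNum_comap_le _ e fun A hA => ?_
  simpa only [ZMod.card] using (hc A hA).le

/-- A prime of the order of the cube root of `n`, by Bertrand's postulate. -/
theorem exists_prime_le_pow_three {n : ℕ} (hn : 1 ≤ n) :
    ∃ p : ℕ, p.Prime ∧ n ≤ p ^ 3 ∧ (p : ℝ) ≤ 4 * (n : ℝ) ^ (1 / 3 : ℝ) := by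
  have hn1 : (1 : ℝ) ≤ n := by exact_mod_cast hn
  set x : ℝ := (n : ℝ) ^ (1 / 3 : ℝ) with hx
  have hx1 : 1 ≤ x := Real.one_le_rpow hn1 (by norm_num)
  have hx3 : x ^ 3 = n := by
    rw [hx, ← Real.rpow_natCast, ← Real.rpow_mul (by positivity)]
    norm_num
  obtain ⟨p, hp, hlt, hle⟩ :=
    Nat.exists_prime_lt_and_le_two_mul ⌈x⌉₊ (Nat.ceil_pos.2 (by linarith)).ne'
  have hxp : x ≤ p := (Nat.le_ceil x).trans (by exact_mod_cast hlt.le)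
  refine ⟨p, hp, ?_, ?_⟩
  · have : (n : ℝ) ≤ (p : ℝ) ^ 3 := hx3 ▸ pow_le_pow_left₀ (by linarith) hxp 3
    exact_mod_cast this
  · have h1 := Nat.ceil_lt_add_one (show 0 ≤ x by linarith)
    have h2 : (p : ℝ) ≤ 2 * ⌈x⌉₊ := by exact_mod_cast hle
    linarith

theorem lemma5p1 (ℓ : ℕ) (hℓ : 2 ≤ ℓ) (γ : ℝ) (hγ0 : 0 < γ)
    (hγ1 : γ < ((ℓ : ℝ) - 1) / ((ℓ : ℝ) ^ 2 + 2 * (ℓ : ℝ))) :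
    ∃ N : ℕ, ∀ n : ℕ, N ≤ n →
      ∃ G : SimpleGraph (Fin n),
        G.CliqueFree (ℓ + 1) ∧ (cliqueIndepNum G ℓ : ℝ) ≤ (n : ℝ) ^ (1 - γ) := by
  have hl : (2 : ℝ) ≤ ℓ := by exact_mod_cast hℓ
  -- All that is needed of the upper bound on `γ`; it amounts to `3 * (ℓ - 1) ≤ ℓ ^ 2 + 2 * ℓ`.
  have hγ : γ < 1 / 3 := by
    refine hγ1.trans_le ?_
    rw [div_le_div_iff₀ (by positivity) (by norm_num)]
    nlinarith
  obtain ⟨M, hM⟩ := exists_mul_pow_pred_lt_pow ℓ (2 * ℓ) (by omega)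
  have hlim : Filter.Tendsto (fun n : ℕ => (n : ℝ) ^ (1 / 3 - γ)) Filter.atTop Filter.atTop :=
    (tendsto_rpow_atTop (by linarith)).comp tendsto_natCast_atTop_atTop
  -- Here `16 = 4 ^ 2` comes from `p ≤ 4 * n ^ (1 / 3)`; the spare power `n ^ (1 / 3 - γ)` absorbs
  -- the constant.
  obtain ⟨N, hN⟩ := Filter.eventually_atTop.1 (hlim.eventually_ge_atTop (16 * M : ℝ))
  refine ⟨max N 1, fun n hn => ?_⟩
  have hn1 : 1 ≤ n := (le_max_right _ _).trans hn
  have hn0 : (0 : ℝ) < n := by exact_mod_cast hn1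
  obtain ⟨p, hp, hnp, hpn⟩ := exists_prime_le_pow_three hn1
  obtain ⟨G, hG, hα⟩ := exists_cliqueFree_cliqueIndepNum_le hℓ hM hp hnp
  refine ⟨G, hG, ?_⟩
  calc (cliqueIndepNum G ℓ : ℝ) ≤ M * (p : ℝ) ^ 2 := by exact_mod_cast hα
    _ ≤ M * (4 * (n : ℝ) ^ (1 / 3 : ℝ)) ^ 2 := by gcongr
    _ = 16 * M * (n : ℝ) ^ (2 / 3 : ℝ) := by
        rw [mul_pow, ← Real.rpow_natCast ((n : ℝ) ^ (1 / 3 : ℝ)), ← Real.rpow_mul hn0.le]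
        norm_num
        ring
    _ ≤ (n : ℝ) ^ (1 / 3 - γ) * (n : ℝ) ^ (2 / 3 : ℝ) := by
        gcongr
        exact hN n ((le_max_left _ _).trans hn)
    _ = (n : ℝ) ^ (1 - γ) := by
        rw [← Real.rpow_add hn0]
        congr 1
        ring
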